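/- For each positive integer $n$ let $\mathbf p=\mathbf p(n)=(p_{11},p_{10},p_{01},p_{00})$ be a probability vector. Let $(G_a,G_b)$ be a pair of random graphs on the vertex set $[n]=\{0,\dots,n-1\}$, given by their edge indicator functions on the set $\binom{[n]}{2}$ of two-element subsets of $[n]$, such that the pairs $(G_a(e),G_b(e))$, $e\in\binom{[n]}{2}$, are i.i.d. and equal to $(i,j)\in\{0,1\}^2$ with probability $p_{ij}$. Let $\Pi$ be a uniformly random permutation of $[n]$, independent of $(G_a,G_b)$, and let $G_c$ be the graph on $[n]$ with $G_c(\{\Pi(i),\Pi(j)\})=G_a(\{i,j\})$ for all $i\ne j$. A maximum a posteriori (MAP) estimator of $\Pi$ given $(G_c,G_b)$ is an estimator which, on observing $(G_c,G_b)=(g_c,g_b)$, returns a permutation $\hat\pi$ that maximizes $P[\Pi=\hat\pi\mid (G_c,G_b)=(g_c,g_b)]$; ties may be broken arbitrarily, possibly at random. **Theorem.** Suppose that, as $n\to\infty$, $$p_{11}\ \ge\ \frac{\log n+\omega(1)}{n},\qquad p_{11}\ \le\ O\!\left(\frac{\log n}{n}\right),\qquad p_{01}+p_{10}\ \le\ O\!\left(\frac1{\log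 n}\right),\qquad \frac{p_{01}p_{10}}{p_{11}p_{00}}\ \le\ O\!\left(\frac1{(\log n)^3}\right),$$ where $\omega(1)$ stands for a sequence that tends to $+\infty$. Then any MAP estimator of $\Pi$ given $(G_c,G_b)$ is correct (that is, equal to $\Pi$) with probability $1-o(1)$. -/

import Mathlib

open Filter Topology Asymptotics
open scoped ENNReal

namespace GraphAlign

/-- The set of unordered pairs of distinct elements of `[n] = {0, …, n-1}`. -/
abbrev VPair (n : ℕ) : Type := {e : Sym2 (Fin n) // ¬ e.IsDiag}

/-- A labelled graph on the vertex set `[n]`, given by its edge indicator function. -/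
abbrev LGraph (n : ℕ) : Type := VPair n → Bool

/-- The lifted permutation of vertex pairs, `{i, j} ↦ {π i, π j}`. -/
def lift {n : ℕ} (π : Equiv.Perm (Fin n)) (e : VPair n) : VPair n :=
  ⟨e.1.map π, fun h => e.2 ((Sym2.isDiag_map π.injective).1 h)⟩

/-- The joint law of a correlated Erdős–Rényi pair `(G_a, G_b)`, seen as one function with values
`(G_a e, G_b e)`: the values at the vertex pairs `e` are i.i.d. with law `p`, where `true` stands
for 1 (presence of the edge) and `false` for 0. -/
noncomputable def erPair (n : ℕ) (p : PMF (Bool × Bool)) : PMF (VPair n → Bool × Bool) :=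
  PMF.ofFintype (fun g => ∏ e, p (g e)) (by
    have h : ∑ b, p b = 1 := by rw [← tsum_fintype (L := .unconditional _)]; exact p.tsum_coe
    rw [← Fintype.prod_sum (fun (_ : VPair n) (b : Bool × Bool) => p b)]
    simp [h])

/-- The joint law of `((G_a, G_b), Π)`: the permutation `Π` is uniform on the permutations of `[n]`
and independent of `(G_a, G_b)`. -/
noncomputable def planted (n : ℕ) (p : PMF (Bool × Bool)) :
    PMF ((VPair n → Bool × Bool) × Equiv.Perm (Fin n)) :=
  (erPair n p).bind fun g => (PMF.uniformOfFintype (Equiv.Perm (Fin n))).map fun π => (g, π)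

/-- The observation `(G_c, G_b)`, where `G_c {Π i, Π j} = G_a {i, j}`,
i.e. `G_c = G_a ∘ lift Π⁻¹`. -/
def observe {n : ℕ} (ω : (VPair n → Bool × Bool) × Equiv.Perm (Fin n)) : LGraph n × LGraph n :=
  (fun e => (ω.1 (lift ω.2⁻¹ e)).1, fun e => (ω.1 e).2)

/-- The posterior probability `P[Π = π | (G_c, G_b) = o]`
(equal to 0 if the observation `o` has probability 0). -/
noncomputable def posterior (n : ℕ) (p : PMF (Bool × Bool)) (o : LGraph n × LGraph n)
    (π : Equiv.Perm (Fin n)) : ℝ≥0∞ :=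
  (planted n p).toOuterMeasure {ω | ω.2 = π ∧ observe ω = o} /
    (planted n p).toOuterMeasure {ω | observe ω = o}

/-- A (possibly randomized) estimator of `Π` given `(G_c, G_b)`: the conditional law of its output
given the observation. A deterministic estimator has values `PMF.pure _`. -/
abbrev Estimator (n : ℕ) : Type := LGraph n × LGraph n → PMF (Equiv.Perm (Fin n))

/-- A maximum a posteriori estimator: each output that it can return is a maximizer of the posterior
probability, with ties broken in an arbitrary, possibly randomized, way. -/
def IsMAP {n : ℕ} (p : PMF (Bool × Bool)) (est : Estimator n) : Prop :=
  ∀ o, ∀ πhat ∈ (est o).support, ∀ π, posterior n p o π ≤ posterior n p o πhat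

/-- The probability that the output of the estimator equals `Π`. -/
noncomputable def successProb {n : ℕ} (p : PMF (Bool × Bool)) (est : Estimator n) : ℝ :=
  (((planted n p).bind fun ω => (est (observe ω)).map fun πhat => (ω.2, πhat)).toOuterMeasure
    {x | x.2 = x.1}).toReal

/-- The probability `p_{ij}`, as a real number. -/
noncomputable def pr (p : PMF (Bool × Bool)) (i j : Bool) : ℝ := (p (i, j)).toReal

end GraphAlign

/-! Relabelling `G_a` by a permutation σ keeps the number of edges of both graphs. The likelihood of
the relabelled pair is therefore that of the true one times (p01 p10 / (p11 p00)) to the power (old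
common edges − new common edges). Since p01 p10 < p11 p00 eventually, MAP recovers Π as soon as
every σ ≠ 1 strictly lowers the number of common edges (`goodEvent`, `eq_of_mem_support_of_isMAP`).
It remains to bound the probability of the complement.

For one σ, the joint generating function of the old and new counts is a sum over the values of `G_a`
of a product of 2×2 kernels linking a pair to its image. Along each cycle it is a trace of a matrix
product, hence at most a product of Frobenius norms (`sum_prod_kernel_le`). This gives Chernoff
bounds of the form (norm)^m, where m is the number of vertex pairs moved by σ
(`sum_pow_le_sqrt_frobSq_pow`).

Let σ move k vertices. At most n^k permutations do so, so a bound (y/n)^k with y → 0 suffices. If k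
≤ 32n/log n, then m is at least k(n − k/2 − 3/2), and the Chernoff parameter z = log n gives
exp(−k(log n + w − O(1))) (`prodProb_small_le`). If k is larger, the k/2 is too costly and the
comparison is split at a threshold of order k log n. The common edges meeting the support are
unlikely to be few; this depends on the support alone, so a union over 2^n sets is enough
(`prodProb_commonIn_touching_le`). And the relabelled graphs are unlikely to share that many edges,
since the expected number of new coincidences is only O(k) (`prodProb_large_le`). -/

namespace GraphAlign

/-! ### Products of kernels along the cycles of a permutation -/

theorem sum_trace_mul_le {β : Type*} [Fintype β] (A B : β → β → ℝ) :
    ∑ a, ∑ b, A a b * B b a ≤ √(∑ a, ∑ b, A a b ^ 2) * √(∑ a, ∑ b, B a b ^ 2) := by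
  have h := Real.sum_mul_le_sqrt_mul_sqrt (Finset.univ : Finset (β × β))
    (fun x => A x.1 x.2) (fun x => B x.2 x.1)
  simp only [Fintype.sum_prod_type] at h
  rwa [Finset.sum_comm (f := fun x y => B y x ^ 2)] at h

theorem sqrt_sum_mul_sq_le {β : Type*} [Fintype β] (A B : β → β → ℝ) :
    √(∑ a, ∑ c, (∑ b, A a b * B b c) ^ 2) ≤
      √(∑ a, ∑ b, A a b ^ 2) * √(∑ a, ∑ b, B a b ^ 2) := by
  rw [← Real.sqrt_mul (by positivity)]
  apply Real.sqrt_le_sqrt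
  calc ∑ a, ∑ c, (∑ b, A a b * B b c) ^ 2
      ≤ ∑ a, ∑ c, (∑ b, A a b ^ 2) * (∑ b, B b c ^ 2) :=
        Finset.sum_le_sum fun a _ => Finset.sum_le_sum fun c _ =>
          Finset.sum_mul_sq_le_sq_mul_sq _ _ _
    _ = (∑ a, ∑ b, A a b ^ 2) * (∑ a, ∑ b, B a b ^ 2) := by
        rw [Finset.sum_comm (f := fun a b => B a b ^ 2), Finset.sum_mul]
        simp_rw [Finset.mul_sum]

/-- A sum over colourings of a product of kernels along the cycles of a permutation is at most the
product of the traces (at fixed points) and of the Frobenius norms (at moved points). -/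
theorem sum_prod_kernel_le {β : Type*} [Fintype β] {ι : Type*} [Fintype ι] [DecidableEq ι]
    (σ : Equiv.Perm ι) (K : ι → β → β → ℝ) (hK : ∀ e a b, 0 ≤ K e a b) :
    ∑ a : ι → β, ∏ e, K e (a e) (a (σ e)) ≤
      ∏ e, if σ e = e then ∑ b, K e b b else √(∑ b, ∑ c, K e b c ^ 2) := by
  classical
  suffices H : ∀ (ι : Type _) [Fintype ι] (σ : Equiv.Perm ι) (K : ι → β → β → ℝ),
      (∀ e a b, 0 ≤ K e a b) → ∑ a : ι → β, ∏ e, K e (a e) (a (σ e)) ≤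
        ∏ e, if σ e = e then ∑ b, K e b b else √(∑ b, ∑ c, K e b c ^ 2) by
    convert H ι σ K hK
  clear hK K σ
  intro ι _
  refine Fintype.induction_empty_option (P := fun ι _ =>
    ∀ (σ : Equiv.Perm ι) (K : ι → β → β → ℝ), (∀ e a b, 0 ≤ K e a b) →
      ∑ a : ι → β, ∏ e, K e (a e) (a (σ e)) ≤
      ∏ e, if σ e = e then ∑ b, K e b b else √(∑ b, ∑ c, K e b c ^ 2)) ?_ ?_ ?_ ι
  · intro α γ _ f ih σ K hK
    let _ := Fintype.ofEquiv γ f.symm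
    have h := ih ((f.trans σ).trans f.symm) (fun e => K (f e)) (fun e => hK _)
    have e1 : ∑ a : α → β, ∏ e, K (f e) (a e) (a (((f.trans σ).trans f.symm) e)) =
        ∑ a : γ → β, ∏ e, K e (a e) (a (σ e)) := by
      rw [← (Equiv.arrowCongr f (Equiv.refl β)).sum_comp]
      refine Finset.sum_congr (by ext; simp) fun a _ => ?_
      rw [← f.prod_comp]
      refine Finset.prod_congr (by ext; simp) fun e _ => ?_
      simp
    have e2 : (∏ e, if ((f.trans σ).trans f.symm) e = e then ∑ b, K (f e) b b
        else √(∑ b, ∑ c, K (f e) b c ^ 2)) =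
        ∏ e, if σ e = e then ∑ b, K e b b else √(∑ b, ∑ c, K e b c ^ 2) := by
      rw [← f.prod_comp]
      refine Finset.prod_congr (by ext; simp) fun e _ => ?_
      simp [Equiv.symm_apply_eq]
    rw [← e1, ← e2]
    exact h
  · intro σ K _
    simp
  · intro α _ ih σ K hK
    have hsum : ∑ a : Option α → β, ∏ e, K e (a e) (a (σ e)) =
        ∑ a : α → β, ∑ b : β, K none b (Option.elim (σ none) b a) *
          ∏ e, K (some e) (a e) (Option.elim (σ (some e)) b a) := by
      rw [← (Equiv.piOptionEquivProd (β := fun _ : Option α => β)).symm.sum_comp,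
        Fintype.sum_prod_type, Finset.sum_comm]
      refine Finset.sum_congr rfl fun a _ => Finset.sum_congr rfl fun b _ => ?_
      have hx : ∀ x : Option α, (Equiv.piOptionEquivProd (β := fun _ : Option α => β)).symm (b, a) x
          = Option.elim x b a := by
        intro x
        cases x <;> rfl
      rw [Fintype.prod_option]
      simp only [hx, Option.elim]
    refine (le_of_eq (Eq.trans (by congr!) hsum)).trans ?_
    rw [Fintype.prod_option]
    by_cases hn : σ none = none
    · have hs : ∀ e, σ (some e) = some (Equiv.removeNone σ e) := by
        intro e
        refine (Equiv.removeNone_some σ ?_).symm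
        refine Option.ne_none_iff_exists'.1 fun h => ?_
        have := σ.injective (h.trans hn.symm)
        simp at this
      simp only [hn, hs, Option.elim, if_true, Option.some.injEq]
      simp_rw [← Finset.sum_mul]
      rw [← Finset.mul_sum]
      exact mul_le_mul_of_nonneg_left (ih _ _ fun e => hK _)
        (Finset.sum_nonneg fun b _ => hK _ _ _)
    · obtain ⟨w, hw⟩ := Option.ne_none_iff_exists'.1 hn
      obtain ⟨x, hx⟩ : ∃ x, σ (some x) = none := by
        obtain ⟨y, hy⟩ := σ.surjective none
        cases y with
        | none => exact absurd hy hn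
        | some x => exact ⟨x, hy⟩
      have hτx : Equiv.removeNone σ x = w := by
        have := Equiv.removeNone_none σ hx
        rw [hw] at this
        exact Option.some.inj this
      have hτ : ∀ e, e ≠ x → σ (some e) = some (Equiv.removeNone σ e) := by
        intro e he
        refine (Equiv.removeNone_some σ ?_).symm
        refine Option.ne_none_iff_exists'.1 fun h => he ?_
        exact Option.some.inj (σ.injective (h.trans hx.symm))
      set τ := Equiv.removeNone σ with hτdef
      -- Remove `none` from its cycle x → none → w: summing over its colour composes the kernels of
      -- x and `none`, and τ sends x straight to w.
      set K' : α → β → β → ℝ := Function.update (fun e => K (some e)) x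
        (fun a c => ∑ b, K (some x) a b * K none b c) with hK'
      have hKx : K' x = fun a c => ∑ b, K (some x) a b * K none b c := by simp [hK']
      have hKe : ∀ e, e ≠ x → K' e = K (some e) := fun e he => by simp [hK', he]
      have h1 : ∀ a : α → β, ∑ b : β, K none b (Option.elim (σ none) b a) *
          ∏ e, K (some e) (a e) (Option.elim (σ (some e)) b a) =
          ∏ e, K' e (a e) (a (τ e)) := by
        intro a
        rw [Fintype.prod_eq_mul_prod_compl x, hKx, hτx, Finset.sum_mul]
        refine Finset.sum_congr rfl fun b _ => ?_
        rw [Fintype.prod_eq_mul_prod_compl x, hx, hw]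
        have : ∏ e ∈ {x}ᶜ, K (some e) (a e) (Option.elim (σ (some e)) b a) =
            ∏ e ∈ {x}ᶜ, K' e (a e) (a (τ e)) := by
          refine Finset.prod_congr rfl fun e he => ?_
          have he : e ≠ x := by simpa using he
          rw [hτ e he, hKe e he]
          rfl
        rw [this]
        simp only [Option.elim]
        ring
      rw [Finset.sum_congr rfl fun a _ => h1 a]
      refine (ih τ K' ?_).trans ?_
      · intro e a b
        by_cases he : e = x
        · subst he
          rw [congrFun (congrFun hKx a) b]
          exact Finset.sum_nonneg fun c _ => mul_nonneg (hK _ _ _) (hK _ _ _)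
        · rw [hKe e he]
          exact hK _ _ _
      · rw [Fintype.prod_eq_mul_prod_compl x, Fintype.prod_eq_mul_prod_compl x, ← mul_assoc]
        have hnorm : ∀ (p : Prop) [Decidable p] (M : β → β → ℝ), (∀ a b, 0 ≤ M a b) →
            0 ≤ if p then ∑ b, M b b else √(∑ b, ∑ c, M b c ^ 2) := by
          intro p _ M hM
          split_ifs
          · exact Finset.sum_nonneg fun b _ => hM _ _
          · positivity
        refine mul_le_mul ?_ (le_of_eq (Finset.prod_congr rfl fun e he => ?_))
          (Finset.prod_nonneg fun e he => hnorm _ _ ?_)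
          (mul_nonneg (@hnorm _ (_) _ (hK _)) (@hnorm _ (_) _ (hK _)))
        · have hx' : ¬ σ (some x) = some x := by simp [hx]
          rw [hKx]
          -- x is fixed by τ exactly when {x, none} was a 2-cycle, which leaves a trace of a
          -- product; otherwise submultiplicativity of the Frobenius norm applies.
          split_ifs
          · exact (sum_trace_mul_le _ _).trans_eq (mul_comm _ _)
          · exact (sqrt_sum_mul_sq_le _ _).trans_eq (mul_comm _ _)
        · have he : e ≠ x := by simpa using he
          rw [hτ e he, hKe e he]
          simp
        · rw [hKe e (by simpa using he)]
          exact hK _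

/-! ### Chernoff bounds under the product law -/

section ProductLaw

variable {E : Type*} [Fintype E] [DecidableEq E]

/-- The probability of an event under the product over `E` of the law `r`. -/
noncomputable def prodProb (r : Bool × Bool → ℝ) (A : Set (E → Bool × Bool)) : ℝ :=
  ∑ g, A.indicator (fun g => ∏ e, r (g e)) g

/-- The number of common edges at the pairs moved by `σ`, after applying `σ`. -/
def newCommon (σ : Equiv.Perm E) (g : E → Bool × Bool) : ℕ :=
  (Finset.univ.filter fun e => σ e ≠ e ∧ (g (σ e)).1 = true ∧ (g e).2 = true).card

/-- The number of common edges at the pairs moved by `σ`. -/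
def oldCommon (σ : Equiv.Perm E) (g : E → Bool × Bool) : ℕ :=
  (Finset.univ.filter fun e => σ e ≠ e ∧ (g e).1 = true ∧ (g e).2 = true).card

/-- The number of common edges in `T`. -/
def commonIn (T : Finset E) (g : E → Bool × Bool) : ℕ :=
  (T.filter fun e => (g e).1 = true ∧ (g e).2 = true).card

/-- The squared Frobenius norm of the symmetrized transfer kernel. -/
def frobSq (r : Bool × Bool → ℝ) (u z : ℝ) : ℝ :=
  (r (false, false) + r (false, true)) ^ 2 + (r (true, false) + r (true, true) * u * z) ^ 2 +
    2 * ((r (false, false) + r (false, true) * z) * (r (true, false) + r (true, true) * u))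

theorem prodProb_mono {r : Bool × Bool → ℝ} (hr : ∀ b, 0 ≤ r b) {A B : Set (E → Bool × Bool)}
    (h : A ⊆ B) : prodProb r A ≤ prodProb r B :=
  Finset.sum_le_sum fun _ _ => Set.indicator_le_indicator_of_subset h
    (fun _ => Finset.prod_nonneg fun _ _ => hr _) _

theorem prodProb_union_le {r : Bool × Bool → ℝ} (hr : ∀ b, 0 ≤ r b)
    (A B : Set (E → Bool × Bool)) : prodProb r (A ∪ B) ≤ prodProb r A + prodProb r B := by
  rw [prodProb, prodProb, prodProb, ← Finset.sum_add_distrib]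
  refine Finset.sum_le_sum fun g _ => ?_
  have h : 0 ≤ ∏ e, r (g e) := Finset.prod_nonneg fun _ _ => hr _
  by_cases hA : g ∈ A <;> by_cases hB : g ∈ B <;> simp [hA, hB, h]

theorem prodProb_biUnion_le {r : Bool × Bool → ℝ} (hr : ∀ b, 0 ≤ r b) {κ : Type*} (s : Finset κ)
    (A : κ → Set (E → Bool × Bool)) :
    prodProb r (⋃ i ∈ s, A i) ≤ ∑ i ∈ s, prodProb r (A i) := by
  classical
  induction s using Finset.induction_on with
  | empty => simp [prodProb]
  | insert i s hi ih =>
    rw [Finset.sum_insert hi, Finset.set_biUnion_insert]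
    exact (prodProb_union_le hr _ _).trans (by gcongr)

theorem prodProb_univ {r : Bool × Bool → ℝ} (h1 : ∑ b, r b = 1) :
    prodProb r (Set.univ : Set (E → Bool × Bool)) = 1 := by
  simp only [prodProb, Set.indicator_univ]
  rw [← Fintype.prod_sum (fun (_ : E) b => r b)]
  simp [h1]

theorem prodProb_compl {r : Bool × Bool → ℝ} (h1 : ∑ b, r b = 1) (A : Set (E → Bool × Bool)) :
    prodProb r Aᶜ = 1 - prodProb r A := by
  rw [← prodProb_univ (E := E) h1, eq_sub_iff_add_eq, prodProb, prodProb, prodProb,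
    ← Finset.sum_add_distrib]
  refine Finset.sum_congr rfl fun g _ => ?_
  by_cases hA : g ∈ A <;> simp [hA]

theorem prodProb_le_of_one_le {r : Bool × Bool → ℝ} (hr : ∀ b, 0 ≤ r b)
    {A : Set (E → Bool × Bool)} {f : (E → Bool × Bool) → ℝ} (hf : ∀ g, 0 ≤ f g)
    (h : ∀ g ∈ A, 1 ≤ f g) : prodProb r A ≤ ∑ g, (∏ e, r (g e)) * f g := by
  refine Finset.sum_le_sum fun g _ => ?_
  have hp : 0 ≤ ∏ e, r (g e) := Finset.prod_nonneg fun _ _ => hr _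
  by_cases hA : g ∈ A
  · simpa [hA] using le_mul_of_one_le_right hp (h g hA)
  · simpa [hA] using mul_nonneg hp (hf g)

omit [Fintype E] [DecidableEq E] in
theorem pow_card_filter (s : Finset E) (P : E → Prop) [DecidablePred P] (u : ℝ) :
    u ^ (s.filter P).card = ∏ e ∈ s, if P e then u else 1 := by
  rw [← Finset.prod_filter, Finset.prod_const]

/-- Given the first graph a, the second-graph bits are summed out pair by pair, leaving a kernel in
(a e, a (σ e)). Fixed pairs contribute total mass 1, moved pairs a Frobenius norm. -/
theorem sum_pow_le_sqrt_frobSq_pow {r : Bool × Bool → ℝ} (hr : ∀ b, 0 ≤ r b) (h1 : ∑ b, r b = 1)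
    (h00 : 0 < r (false, false)) (h11 : 0 < r (true, true)) {u z : ℝ} (hu : 0 < u) (hz : 0 < z)
    (σ : Equiv.Perm E) :
    ∑ g, (∏ e, r (g e)) * (u ^ oldCommon σ g * z ^ newCommon σ g) ≤
      √(frobSq r u z) ^ (Finset.univ.filter fun e => σ e ≠ e).card := by
  set A : Bool → Bool → ℝ := fun a a' => ∑ b, r (a, b) *
    ((if a = true ∧ b = true then u else 1) * (if a' = true ∧ b = true then z else 1)) with hA
  have hA01 : 0 < A false true := by
    have := hr (false, true)
    simp only [hA, Fintype.sum_bool]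
    norm_num
    positivity
  have hA10 : 0 < A true false := by
    have := hr (true, false)
    simp only [hA, Fintype.sum_bool]
    norm_num
    positivity
  -- Diagonal conjugation that makes both off-diagonal entries of A equal to √(A01 A10), minimizing
  -- the Frobenius norm. The factors s (a (σ e)) / s (a e) cancel in the product over all e.
  set s : Bool → ℝ := fun a => if a then √(A true false / A false true) else 1 with hs
  have hspos : ∀ a, 0 < s a := by
    intro a
    simp only [hs]
    split_ifs <;> positivity
  have hA0 : ∀ a a', 0 ≤ A a a' := by
    intro a a'
    refine Finset.sum_nonneg fun b _ => mul_nonneg (hr _) (mul_nonneg ?_ ?_) <;>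
    · split_ifs <;> positivity
  set K : E → Bool → Bool → ℝ := fun e a a' =>
    (if σ e = e then ∑ b, r (a, b) else A a a') * (s a' / s a) with hK
  have hK0 : ∀ e a b, 0 ≤ K e a b := by
    intro e a b
    refine mul_nonneg ?_ (div_pos (hspos _) (hspos _)).le
    split_ifs
    · exact Finset.sum_nonneg fun b _ => hr _
    · exact hA0 _ _
  have hLHS : ∑ g : E → Bool × Bool, (∏ e, r (g e)) * (u ^ oldCommon σ g * z ^ newCommon σ g) =
      ∑ a : E → Bool, ∏ e, K e (a e) (a (σ e)) := by
    rw [← (Equiv.arrowProdEquivProdArrow E (fun _ => Bool) (fun _ => Bool)).symm.sum_comp,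
      Fintype.sum_prod_type]
    refine Finset.sum_congr rfl fun a _ => ?_
    have e1 : ∏ e, K e (a e) (a (σ e)) =
        ∏ e, (if σ e = e then ∑ b, r (a e, b) else A (a e) (a (σ e))) := by
      rw [hK, Finset.prod_mul_distrib, Finset.prod_div_distrib,
        Equiv.prod_comp σ (fun e => s (a e)), div_self, mul_one]
      exact (Finset.prod_pos fun e _ => hspos _).ne'
    have e2 : ∀ e, (if σ e = e then ∑ b, r (a e, b) else A (a e) (a (σ e))) =
        ∑ b, r (a e, b) * ((if σ e ≠ e ∧ a e = true ∧ b = true then u else 1) *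
          (if σ e ≠ e ∧ a (σ e) = true ∧ b = true then z else 1)) := by
      intro e
      by_cases he : σ e = e <;> simp [he, hA]
    rw [e1, Finset.prod_congr rfl fun e _ => e2 e, Fintype.prod_sum]
    refine Finset.sum_congr rfl fun b _ => ?_
    rw [oldCommon, newCommon, pow_card_filter, pow_card_filter, ← Finset.prod_mul_distrib,
      ← Finset.prod_mul_distrib]
    rfl
  rw [hLHS]
  refine (sum_prod_kernel_le σ K hK0).trans_eq ?_
  rw [← Finset.prod_const, Finset.prod_filter]
  refine Finset.prod_congr rfl fun e _ => ?_
  by_cases he : σ e = e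
  · have hd : ∀ b, s b / s b = 1 := fun b => div_self (hspos b).ne'
    simp only [he, hK, if_true, hd, mul_one, ne_eq, not_true_eq_false, if_false]
    rw [← h1, Fintype.sum_prod_type]
  · simp only [he, hK, if_false, ne_eq, not_false_eq_true, if_true]
    congr 1
    have hsq : s true ^ 2 = A true false / A false true := by
      simp only [hs, if_true]
      exact Real.sq_sqrt (by positivity)
    have hsf : s false = 1 := by simp [hs]
    have hst := (hspos true).ne'
    simp only [Fintype.sum_bool, hsf, div_one, one_div, mul_pow, div_self hst, inv_pow, hsq,
      one_pow, mul_one]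
    have g1 : A true false ^ 2 * (A true false / A false true)⁻¹ =
        A false true * A true false := by
      field_simp
    have g2 : A false true ^ 2 * (A true false / A false true) =
        A false true * A true false := by
      field_simp
    rw [g1, g2]
    simp only [frobSq, hA, Fintype.sum_bool]
    norm_num
    ring

theorem prodProb_oldCommon_le_newCommon_le {r : Bool × Bool → ℝ} (hr : ∀ b, 0 ≤ r b)
    (h1 : ∑ b, r b = 1) (h00 : 0 < r (false, false)) (h11 : 0 < r (true, true)) {z : ℝ}
    (hz : 1 ≤ z) (σ : Equiv.Perm E) :
    prodProb r {g | oldCommon σ g ≤ newCommon σ g} ≤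
      √(frobSq r z⁻¹ z) ^ (Finset.univ.filter fun e => σ e ≠ e).card := by
  have hz0 : 0 < z := by linarith
  refine (prodProb_le_of_one_le hr (f := fun g => z⁻¹ ^ oldCommon σ g * z ^ newCommon σ g)
    (fun g => by positivity) ?_).trans
    (sum_pow_le_sqrt_frobSq_pow hr h1 h00 h11 (inv_pos.2 hz0) hz0 σ)
  intro g hg
  rw [inv_pow, ← div_eq_inv_mul, one_le_div (by positivity)]
  exact pow_le_pow_right₀ hz hg

theorem prodProb_le_newCommon_le {r : Bool × Bool → ℝ} (hr : ∀ b, 0 ≤ r b)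
    (h1 : ∑ b, r b = 1) (h00 : 0 < r (false, false)) (h11 : 0 < r (true, true)) {s : ℝ}
    (hs : 0 ≤ s) (t : ℝ) (σ : Equiv.Perm E) :
    prodProb r {g | t ≤ newCommon σ g} ≤ Real.exp (-(s * t)) *
      √(frobSq r 1 (Real.exp s)) ^ (Finset.univ.filter fun e => σ e ≠ e).card := by
  refine (prodProb_le_of_one_le hr (f := fun g => Real.exp (-(s * t)) *
    (1 ^ oldCommon σ g * Real.exp s ^ newCommon σ g)) (fun g => by positivity) ?_).trans ?_
  · intro g hg
    rw [one_pow, one_mul, ← Real.exp_nat_mul, ← Real.exp_add, Real.one_le_exp_iff]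
    have : s * t ≤ s * newCommon σ g := mul_le_mul_of_nonneg_left hg hs
    linarith
  · simp_rw [mul_left_comm _ (Real.exp (-(s * t)))]
    rw [← Finset.mul_sum]
    exact mul_le_mul_of_nonneg_left
      (sum_pow_le_sqrt_frobSq_pow hr h1 h00 h11 one_pos (Real.exp_pos s) σ) (Real.exp_pos _).le

/-- Chernoff with parameter 1: each pair in T contributes at most 1 − r11/2 ≤ exp(−r11/2), because
e⁻¹ ≤ 1/2. -/
theorem prodProb_commonIn_le_le {r : Bool × Bool → ℝ} (hr : ∀ b, 0 ≤ r b)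
    (h1 : ∑ b, r b = 1) (T : Finset E) (t : ℝ) :
    prodProb r {g | commonIn T g ≤ t} ≤ Real.exp (t - r (true, true) * T.card / 2) := by
  have hexp : Real.exp (-1) ≤ 1 / 2 := by
    rw [Real.exp_neg, inv_eq_one_div]
    exact one_div_le_one_div_of_le (by norm_num) (by linarith [Real.add_one_le_exp (1 : ℝ)])
  refine (prodProb_le_of_one_le hr (f := fun g => Real.exp t * Real.exp (-1) ^ commonIn T g)
    (fun g => by positivity) ?_).trans ?_
  · intro g hg
    rw [← Real.exp_nat_mul, ← Real.exp_add, Real.one_le_exp_iff]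
    have : (commonIn T g : ℝ) ≤ t := hg
    linarith
  · simp_rw [mul_left_comm _ (Real.exp t)]
    rw [← Finset.mul_sum, sub_eq_add_neg, Real.exp_add]
    refine mul_le_mul_of_nonneg_left ?_ (Real.exp_pos _).le
    have e1 : ∀ g : E → Bool × Bool, (∏ e, r (g e)) * Real.exp (-1) ^ commonIn T g =
        ∏ e, r (g e) * (if e ∈ T ∧ (g e).1 = true ∧ (g e).2 = true then Real.exp (-1) else 1) := by
      intro g
      rw [Finset.prod_mul_distrib, ← pow_card_filter, commonIn]
      congr 3
      ext e
      simp
    simp_rw [e1]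
    rw [← Fintype.prod_sum (fun (e : E) (b : Bool × Bool) =>
      r b * (if e ∈ T ∧ b.1 = true ∧ b.2 = true then Real.exp (-1) else 1))]
    have e2 : Real.exp (-(r (true, true) * T.card / 2)) =
        ∏ e, if e ∈ T then Real.exp (-(r (true, true) / 2)) else 1 := by
      rw [← pow_card_filter, ← Real.exp_nat_mul]
      congr 1
      simp
      ring
    rw [e2]
    refine Finset.prod_le_prod (fun e _ => Finset.sum_nonneg fun b _ => mul_nonneg (hr b) ?_) ?_
    · split_ifs <;> positivity
    · intro e _
      simp only [Fintype.sum_prod_type, Fintype.sum_bool] at h1 ⊢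
      by_cases he : e ∈ T
      · simp [he]
        have := Real.add_one_le_exp (-(r (true, true) / 2))
        have := mul_le_mul_of_nonneg_left hexp (hr (true, true))
        linarith
      · simp [he]
        linarith

end ProductLaw

/-! ### Vertex pairs moved by a permutation, and counting permutations -/

theorem lift_lift {n : ℕ} (π τ : Equiv.Perm (Fin n)) (e : VPair n) :
    lift π (lift τ e) = lift (π * τ) e := by
  apply Subtype.ext
  simp [lift, Sym2.map_map]

theorem lift_one {n : ℕ} (e : VPair n) : lift (1 : Equiv.Perm (Fin n)) e = e := by
  apply Subtype.ext
  simp [lift]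

/-- The lifted permutation as an equivalence. -/
def liftPerm {n : ℕ} (π : Equiv.Perm (Fin n)) : Equiv.Perm (VPair n) where
  toFun := lift π
  invFun := lift π⁻¹
  left_inv e := by rw [lift_lift, inv_mul_cancel, lift_one]
  right_inv e := by rw [lift_lift, mul_inv_cancel, lift_one]

/-- The vertex pairs that meet `S`. -/
def touching {n : ℕ} (S : Finset (Fin n)) : Finset (VPair n) :=
  Finset.univ.filter fun e => ∃ i ∈ S, i ∈ e.1

theorem two_mul_choose_two (m : ℕ) : (2 * m.choose 2 : ℝ) = m * (m - 1) := by
  rw [Nat.cast_choose_two]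
  ring

theorem card_touching {n : ℕ} (S : Finset (Fin n)) :
    ((touching S).card : ℝ) = S.card * (n - S.card / 2 - 1 / 2) := by
  have h1 : (touching S).card + (Finset.univ.filter fun e : VPair n => ¬ ∃ i ∈ S, i ∈ e.1).card =
      n.choose 2 := by
    rw [touching, Finset.card_filter_add_card_filter_not, Finset.card_univ,
      Sym2.card_subtype_not_diag, Fintype.card_fin]
  have h2 : (Finset.univ.filter fun e : VPair n => ¬ ∃ i ∈ S, i ∈ e.1).card =
      (n - S.card).choose 2 := by
    have hc : n - S.card = Sᶜ.card := by rw [Finset.card_compl, Fintype.card_fin]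
    rw [hc, ← Sym2.card_image_offDiag,
      ← Finset.card_map (Function.Embedding.subtype _)]
    congr 1
    ext e
    induction e using Sym2.ind with
    | _ x y =>
      simp only [Finset.mem_map, Finset.mem_filter, Finset.mem_univ, true_and,
        Function.Embedding.subtype_apply, Subtype.exists, exists_and_right, exists_eq_right,
        Finset.mem_image, Finset.mem_offDiag, Finset.mem_compl, Prod.exists]
      constructor
      · rintro ⟨hd, h⟩
        refine ⟨x, y, ⟨fun hx => h ⟨x, hx, by simp⟩, fun hy => h ⟨y, hy, by simp⟩, ?_⟩, rfl⟩
        simpa using hd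
      · rintro ⟨a, b, ⟨ha, hb, hab⟩, h⟩
        rw [← h]
        refine ⟨by simpa using hab, ?_⟩
        rintro ⟨i, hi, hi'⟩
        rcases Sym2.mem_iff.1 hi' with rfl | rfl
        · exact ha hi
        · exact hb hi
  have hk : S.card ≤ n := by simpa using S.card_le_univ
  rw [h2] at h1
  have h3 : (2 * (touching S).card + 2 * ((n - S.card).choose 2 : ℕ) : ℝ) = 2 * n.choose 2 := by
    rw [← h1]
    push_cast
    ring
  rw [two_mul_choose_two, two_mul_choose_two, Nat.cast_sub hk] at h3
  linarith

theorem moved_subset_touching {n : ℕ} (σ : Equiv.Perm (Fin n)) :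
    (Finset.univ.filter fun e => liftPerm σ e ≠ e) ⊆ touching σ.support := by
  intro e he
  rw [Finset.mem_filter] at he
  rw [touching, Finset.mem_filter]
  refine ⟨Finset.mem_univ _, ?_⟩
  by_contra hne
  push Not at hne
  apply he.2
  apply Subtype.ext
  show e.1.map σ = e.1
  refine (Sym2.map_congr (g := id) fun i hi => ?_).trans (by simp)
  by_contra h
  exact hne i (Equiv.Perm.mem_support.2 h) hi

/-- A fixed pair containing a moved vertex i also contains σ i, so it equals {i, σ i}; there is at
most one for each i. -/
theorem card_touching_sdiff_le {n : ℕ} (σ : Equiv.Perm (Fin n)) :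
    (touching σ.support \ Finset.univ.filter fun e => liftPerm σ e ≠ e).card ≤
      σ.support.card := by
  rw [← Finset.card_map (Function.Embedding.subtype _)]
  refine (Finset.card_le_card (t := σ.support.image fun i => s(i, σ i)) ?_).trans
    Finset.card_image_le
  intro e he
  rw [Finset.mem_map] at he
  obtain ⟨e, he, rfl⟩ := he
  simp only [touching, Finset.mem_sdiff, Finset.mem_filter, Finset.mem_univ, true_and,
    not_not] at he
  obtain ⟨⟨i, hi, hie⟩, hfix⟩ := he
  have hfix : e.1.map σ = e.1 := congrArg Subtype.val hfix
  have hσ : σ i ∈ e.1 := by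
    rw [← hfix]
    exact Sym2.mem_map.2 ⟨i, hie, rfl⟩
  refine Finset.mem_image.2 ⟨i, hi, ?_⟩
  exact ((Sym2.mem_and_mem_iff (Equiv.Perm.mem_support.1 hi).symm).1 ⟨hie, hσ⟩).symm

theorem le_card_moved {n : ℕ} (σ : Equiv.Perm (Fin n)) :
    (σ.support.card : ℝ) * (n - σ.support.card / 2 - 3 / 2) ≤
      (Finset.univ.filter fun e => liftPerm σ e ≠ e).card := by
  have h1 := card_touching σ.support
  have h2 := Finset.card_sdiff_add_card_eq_card (moved_subset_touching σ)
  have h3 := card_touching_sdiff_le σ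
  have h4 : (touching σ.support).card ≤ σ.support.card +
      (Finset.univ.filter fun e => liftPerm σ e ≠ e).card := by omega
  have h5 : ((touching σ.support).card : ℝ) ≤ σ.support.card +
      (Finset.univ.filter fun e => liftPerm σ e ≠ e).card := by exact_mod_cast h4
  linarith

theorem card_moved_le {n : ℕ} (σ : Equiv.Perm (Fin n)) :
    ((Finset.univ.filter fun e => liftPerm σ e ≠ e).card : ℝ) ≤ σ.support.card * n := by
  have h1 := card_touching σ.support
  have h2 : ((Finset.univ.filter fun e => liftPerm σ e ≠ e).card : ℝ) ≤
    (touching σ.support).card := by exact_mod_cast Finset.card_le_card (moved_subset_touching σ)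
  have h3 : (0 : ℝ) ≤ σ.support.card := by positivity
  nlinarith

theorem commonIn_touching_le {n : ℕ} (σ : Equiv.Perm (Fin n)) (g : VPair n → Bool × Bool) :
    commonIn (touching σ.support) g ≤ oldCommon (liftPerm σ) g + σ.support.card := by
  refine le_trans ?_ (Nat.add_le_add_left (card_touching_sdiff_le σ) _)
  rw [commonIn, oldCommon]
  refine le_trans (Finset.card_le_card ?_) (Finset.card_union_le _ _)
  intro e
  simp only [Finset.mem_filter, Finset.mem_union, Finset.mem_sdiff, Finset.mem_univ, true_and]
  tauto

/-- Choose the support and then permute it: C(n, k) · k! is the descending factorial, at most n^k.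
-/
theorem card_perm_support_card_eq_le (n k : ℕ) :
    (Finset.univ.filter fun σ : Equiv.Perm (Fin n) => σ.support.card = k).card ≤ n ^ k := by
  classical
  have h : (Finset.univ.filter fun σ : Equiv.Perm (Fin n) => σ.support.card = k) ⊆
      (Finset.powersetCard k Finset.univ).biUnion fun S =>
        Finset.univ.filter fun σ : Equiv.Perm (Fin n) => ∀ a, ¬ a ∈ S → σ a = a := by
    intro σ hσ
    simp only [Finset.mem_filter, Finset.mem_univ, true_and, Finset.mem_biUnion,
      Finset.mem_powersetCard, Finset.subset_univ] at hσ ⊢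
    exact ⟨σ.support, hσ, fun a ha => by simpa using ha⟩
  refine (Finset.card_le_card h).trans (Finset.card_biUnion_le.trans ?_)
  have hS : ∀ S ∈ Finset.powersetCard k (Finset.univ : Finset (Fin n)),
      (Finset.univ.filter fun σ : Equiv.Perm (Fin n) => ∀ a, ¬ a ∈ S → σ a = a).card =
        k.factorial := by
    intro S hS
    rw [← Fintype.card_subtype, ← Fintype.card_congr
      (Equiv.Perm.subtypeEquivSubtypePerm (fun a => a ∈ S)), Fintype.card_perm,
      Fintype.card_coe, (Finset.mem_powersetCard.1 hS).2]
  rw [Finset.sum_congr rfl hS, Finset.sum_const, Finset.card_powersetCard, Finset.card_univ,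
    Fintype.card_fin, smul_eq_mul, mul_comm, ← Nat.descFactorial_eq_factorial_mul_choose]
  exact Nat.descFactorial_le_pow n k

theorem sum_perm_pow_support_card_le {n : ℕ} (hn : 0 < n) {y : ℝ} (hy : 0 ≤ y)
    (hy2 : y ≤ 1 / 2) :
    ∑ σ : Equiv.Perm (Fin n) with σ ≠ 1, (y / n) ^ σ.support.card ≤ 2 * y := by
  have hn' : (0 : ℝ) < n := by exact_mod_cast hn
  have hmaps : ∀ σ ∈ (Finset.univ.filter fun σ : Equiv.Perm (Fin n) => σ ≠ 1),
      σ.support.card ∈ Finset.Ico 1 (n + 1) := by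
    intro σ hσ
    have h1 : σ.support.card ≤ n := by simpa using σ.support.card_le_univ
    have h2 : 0 < σ.support.card := by
      rw [Finset.card_pos, Finset.nonempty_iff_ne_empty, ne_eq, Equiv.Perm.support_eq_empty_iff]
      exact (Finset.mem_filter.1 hσ).2
    rw [Finset.mem_Ico]
    omega
  rw [← Finset.sum_fiberwise_of_maps_to hmaps]
  calc _ ≤ ∑ k ∈ Finset.Ico 1 (n + 1), y ^ k := by
        refine Finset.sum_le_sum fun k _ => ?_
        calc _ = ∑ σ ∈ (Finset.univ.filter fun σ : Equiv.Perm (Fin n) => σ ≠ 1) with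
                σ.support.card = k, (y / n) ^ k :=
              Finset.sum_congr rfl fun σ hσ => by rw [(Finset.mem_filter.1 hσ).2]
          _ ≤ ((n : ℝ) ^ k) * (y / n) ^ k := by
              rw [Finset.sum_const, nsmul_eq_mul]
              refine mul_le_mul_of_nonneg_right ?_ (by positivity)
              have := (Finset.card_le_card (Finset.filter_subset_filter (fun σ => σ.support.card = k)
                (Finset.filter_subset (fun σ : Equiv.Perm (Fin n) => σ ≠ 1) Finset.univ))).trans
                  (card_perm_support_card_eq_le n k)
              exact_mod_cast this
          _ = y ^ k := by
              rw [← mul_pow]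
              congr 1
              field_simp
    _ ≤ y ^ 1 / (1 - y) := geom_sum_Ico_le_of_lt_one hy (by linarith)
    _ ≤ 2 * y := by
        rw [pow_one, div_le_iff₀ (by linarith)]
        nlinarith

/-! ### Likelihood, posterior and the MAP estimator -/

theorem prod_eq_pow_card {E : Type*} [Fintype E] (r : Bool × Bool → ℝ) (h : E → Bool × Bool) :
    ∏ e, r (h e) =
      r (true, true) ^ (Finset.univ.filter fun e => h e = (true, true)).card *
      r (true, false) ^ (Finset.univ.filter fun e => h e = (true, false)).card *
      (r (false, true) ^ (Finset.univ.filter fun e => h e = (false, true)).card *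
      r (false, false) ^ (Finset.univ.filter fun e => h e = (false, false)).card) := by
  rw [← Finset.prod_fiberwise' Finset.univ h r]
  simp [Fintype.prod_prod_type]

/-- If moving the first graph by `τ` does not decrease the likelihood, then it does not decrease
the number of common edges. -/
theorem oldCommon_le_newCommon_of_prod_le {E : Type*} [Fintype E] [DecidableEq E]
    {r : Bool × Bool → ℝ} (hr : ∀ b, 0 ≤ r b)
    (hcor : r (false, true) * r (true, false) < r (true, true) * r (false, false))
    (τ : Equiv.Perm E) (g : E → Bool × Bool) (hpos : 0 < ∏ e, r (g e))
    (hle : ∏ e, r (g e) ≤ ∏ e, r ((g (τ e)).1, (g e).2)) :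
    oldCommon τ g ≤ newCommon τ g := by
  set g' : E → Bool × Bool := fun e => ((g (τ e)).1, (g e).2) with hg'
  let N : (E → Bool × Bool) → Bool × Bool → ℕ := fun h b =>
    (Finset.univ.filter fun e => h e = b).card
  have hfst : ∀ h : E → Bool × Bool, N h (true, true) + N h (true, false) =
      (Finset.univ.filter fun e => (h e).1 = true).card := by
    intro h
    rw [← Finset.card_filter_add_card_filter_not (s := Finset.univ.filter fun e => (h e).1 = true)
      (fun e => (h e).2 = true), Finset.filter_filter, Finset.filter_filter]
    refine congrArg₂ (· + ·) (congrArg Finset.card ?_) (congrArg Finset.card ?_) <;>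
      ext e <;> simp [Prod.ext_iff]
  have hsnd : ∀ h : E → Bool × Bool, N h (true, true) + N h (false, true) =
      (Finset.univ.filter fun e => (h e).2 = true).card := by
    intro h
    rw [← Finset.card_filter_add_card_filter_not (s := Finset.univ.filter fun e => (h e).2 = true)
      (fun e => (h e).1 = true), Finset.filter_filter, Finset.filter_filter]
    refine congrArg₂ (· + ·) (congrArg Finset.card ?_) (congrArg Finset.card ?_) <;>
      ext e <;> simp [Prod.ext_iff, and_comm]
  have hnot : ∀ h : E → Bool × Bool, N h (false, true) + N h (false, false) =
      (Finset.univ.filter fun e => ¬ (h e).1 = true).card := by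
    intro h
    rw [← Finset.card_filter_add_card_filter_not (s := Finset.univ.filter fun e => ¬ (h e).1 = true)
      (fun e => (h e).2 = true), Finset.filter_filter, Finset.filter_filter]
    refine congrArg₂ (· + ·) (congrArg Finset.card ?_) (congrArg Finset.card ?_) <;>
      ext e <;> simp [Prod.ext_iff]
  have e1 : (Finset.univ.filter fun e => (g' e).1 = true).card =
      (Finset.univ.filter fun e => (g e).1 = true).card :=
    Finset.card_equiv τ (by simp [hg'])
  have e2 : (Finset.univ.filter fun e => ¬ (g' e).1 = true).card =
      (Finset.univ.filter fun e => ¬ (g e).1 = true).card :=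
    Finset.card_equiv τ (by simp [hg'])
  have e3 : N g' (true, true) + N g' (false, true) = N g (true, true) + N g (false, true) :=
    (hsnd g').trans (hsnd g).symm
  rw [← hfst, ← hfst] at e1
  rw [← hnot, ← hnot] at e2
  let F : ℕ := (Finset.univ.filter fun e => τ e = e ∧ g e = (true, true)).card
  have hold : N g (true, true) = oldCommon τ g + F := by
    show (Finset.univ.filter fun e => g e = (true, true)).card = _
    rw [← Finset.card_filter_add_card_filter_not (fun e => τ e ≠ e), Finset.filter_filter,
      Finset.filter_filter]
    congr 2 <;> ext e <;> simp [Prod.ext_iff, and_comm]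
  have hnew : N g' (true, true) = newCommon τ g + F := by
    show (Finset.univ.filter fun e => g' e = (true, true)).card = _
    rw [← Finset.card_filter_add_card_filter_not (fun e => τ e ≠ e), Finset.filter_filter,
      Finset.filter_filter]
    congr 2 <;> ext e
    · simp [hg', and_comm]
    · simp only [hg', Finset.mem_filter, Finset.mem_univ, true_and, not_not,
        Prod.ext_iff]
      constructor
      · rintro ⟨⟨h1, h2⟩, h3⟩
        rw [h3] at h1
        exact ⟨h3, h1, h2⟩
      · rintro ⟨h3, h1, h2⟩
        rw [h3]
        exact ⟨⟨h1, h2⟩, rfl⟩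
  -- With both edge counts preserved, losing k + 1 common edges turns k + 1 pairs of types (11, 00)
  -- into types (10, 01), which multiplies the likelihood by the same power of p01 p10 / (p11 p00) <
  -- 1.
  by_contra hlt
  push Not at hlt
  obtain ⟨k, hk⟩ := Nat.exists_eq_add_of_lt hlt
  have n11 : N g (true, true) = N g' (true, true) + (k + 1) := by omega
  have n10 : N g' (true, false) = N g (true, false) + (k + 1) := by omega
  have n01 : N g' (false, true) = N g (false, true) + (k + 1) := by omega
  have n00 : N g (false, false) = N g' (false, false) + (k + 1) := by omega
  have p1 : ∏ e, r (g e) = r (true, true) ^ N g (true, true) * r (true, false) ^ N g (true, false) *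
    (r (false, true) ^ N g (false, true) * r (false, false) ^ N g (false, false)) :=
    prod_eq_pow_card r g
  have p2 : ∏ e, r ((g (τ e)).1, (g e).2) = r (true, true) ^ N g' (true, true) *
    r (true, false) ^ N g' (true, false) *
    (r (false, true) ^ N g' (false, true) * r (false, false) ^ N g' (false, false)) :=
    prod_eq_pow_card r g'
  have key : (∏ e, r ((g (τ e)).1, (g e).2)) * (r (true, true) * r (false, false)) ^ (k + 1) =
      (∏ e, r (g e)) * (r (false, true) * r (true, false)) ^ (k + 1) := by
    rw [p1, p2, n11, n10, n01, n00]
    ring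
  have hlt2 : (r (false, true) * r (true, false)) ^ (k + 1) <
      (r (true, true) * r (false, false)) ^ (k + 1) :=
    pow_lt_pow_left₀ hcor (mul_nonneg (hr _) (hr _)) (by omega)
  have h3 := mul_lt_mul_of_pos_left hlt2 hpos
  rw [← key] at h3
  have h4 := mul_le_mul_of_nonneg_right hle
    (pow_nonneg (mul_nonneg (hr (true, true)) (hr (false, false))) (k + 1))
  linarith

theorem planted_apply {n : ℕ} (p : PMF (Bool × Bool)) (g : VPair n → Bool × Bool)
    (π : Equiv.Perm (Fin n)) :
    planted n p (g, π) = (∏ e, p (g e)) * (Fintype.card (Equiv.Perm (Fin n)) : ℝ≥0∞)⁻¹ := by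
  rw [planted, PMF.bind_apply, tsum_eq_single g]
  · rw [PMF.map_apply, tsum_eq_single π]
    · simp [erPair]
    · intro τ hτ
      simp [hτ.symm]
  · intro g' hg'
    rw [PMF.map_apply]
    simp [hg'.symm]

/-- The graph pair determined by an observation and a permutation. -/
def unobserve {n : ℕ} (o : LGraph n × LGraph n) (π : Equiv.Perm (Fin n)) : VPair n → Bool × Bool :=
  fun e => (o.1 (lift π e), o.2 e)

theorem observe_eq_iff {n : ℕ} (g : VPair n → Bool × Bool) (π : Equiv.Perm (Fin n))
    (o : LGraph n × LGraph n) : observe (g, π) = o ↔ g = unobserve o π := by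
  constructor
  · rintro rfl
    funext e
    simp [unobserve, observe, lift_lift, lift_one]
  · rintro rfl
    simp [unobserve, observe, lift_lift, lift_one]

theorem posterior_eq {n : ℕ} (p : PMF (Bool × Bool)) (o : LGraph n × LGraph n)
    (π : Equiv.Perm (Fin n)) :
    posterior n p o π = (∏ e, p (unobserve o π e)) *
      (Fintype.card (Equiv.Perm (Fin n)) : ℝ≥0∞)⁻¹ /
        (planted n p).toOuterMeasure {ω | observe ω = o} := by
  have : {ω : (VPair n → Bool × Bool) × Equiv.Perm (Fin n) | ω.2 = π ∧ observe ω = o} =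
      {(unobserve o π, π)} := by
    ext ⟨g, τ⟩
    simp only [Set.mem_ofPred_eq, Set.mem_singleton_iff, Prod.mk.injEq]
    constructor
    · rintro ⟨rfl, h⟩
      exact ⟨(observe_eq_iff _ _ _).1 h, rfl⟩
    · rintro ⟨h, rfl⟩
      exact ⟨rfl, (observe_eq_iff _ _ _).2 h⟩
  rw [posterior, this, PMF.toOuterMeasure_apply_singleton, planted_apply]

theorem toOuterMeasure_le_one {α : Type*} (q : PMF α) (s : Set α) : q.toOuterMeasure s ≤ 1 := by
  rw [PMF.toOuterMeasure_apply, ← q.tsum_coe]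
  exact ENNReal.tsum_le_tsum fun a => Set.indicator_le_self _ _ a

/-- The event that every nontrivial relabelling has strictly fewer common edges. -/
def goodEvent (n : ℕ) : Set (VPair n → Bool × Bool) :=
  {g | ∀ σ : Equiv.Perm (Fin n), σ ≠ 1 → newCommon (liftPerm σ) g < oldCommon (liftPerm σ) g}

/-- The normalizing constant cancels, so the posteriors of π and πhat compare as the likelihoods of
g and of g relabelled by π⁻¹ πhat; on the good event this forces π⁻¹ πhat = 1. -/
theorem eq_of_mem_support_of_isMAP {n : ℕ} {p : PMF (Bool × Bool)} {est : Estimator n}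
    (hest : IsMAP p est) (hcor : pr p false true * pr p true false <
      pr p true true * pr p false false)
    {g : VPair n → Bool × Bool} (hg : g ∈ goodEvent n) (hpos : ∏ e, p (g e) ≠ 0)
    {π πhat : Equiv.Perm (Fin n)} (h : πhat ∈ (est (observe (g, π))).support) : πhat = π := by
  have hmap := hest _ _ h π
  set o := observe (g, π) with ho
  have hgo : g = unobserve o π := (observe_eq_iff _ _ _).1 ho.symm
  rw [posterior_eq, posterior_eq, ← hgo] at hmap
  have hcard0 : (Fintype.card (Equiv.Perm (Fin n)) : ℝ≥0∞)⁻¹ ≠ 0 := by simp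
  have hcardt : (Fintype.card (Equiv.Perm (Fin n)) : ℝ≥0∞)⁻¹ ≠ ⊤ := by
    simp [Fintype.card_ne_zero]
  have hD0 : (planted n p).toOuterMeasure {ω | observe ω = o} ≠ 0 := by
    have hle : (planted n p).toOuterMeasure {(g, π)} ≤
        (planted n p).toOuterMeasure {ω | observe ω = o} :=
      MeasureTheory.measure_mono (by simp [ho])
    rw [PMF.toOuterMeasure_apply_singleton, planted_apply] at hle
    exact (lt_of_lt_of_le (pos_iff_ne_zero.2 (mul_ne_zero hpos hcard0)) hle).ne'
  have hDt : (planted n p).toOuterMeasure {ω | observe ω = o} ≠ ⊤ :=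
    ne_top_of_le_ne_top ENNReal.one_ne_top (toOuterMeasure_le_one _ _)
  have hmul := mul_le_mul_left hmap ((planted n p).toOuterMeasure {ω | observe ω = o})
  rw [ENNReal.div_mul_cancel hD0 hDt, ENNReal.div_mul_cancel hD0 hDt] at hmul
  rw [ENNReal.mul_le_mul_iff_left hcard0 hcardt] at hmul
  have hun : ∀ e, unobserve o πhat e = ((g (liftPerm (π⁻¹ * πhat) e)).1, (g e).2) := by
    intro e
    simp [unobserve, ho, observe, lift_lift, liftPerm]
  simp_rw [hun] at hmul
  have htop : ∀ h : VPair n → Bool × Bool, ∏ e, p (h e) ≠ ⊤ := fun h =>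
    ENNReal.prod_ne_top fun e _ => p.apply_ne_top _
  have hreal := ENNReal.toReal_mono (htop _) hmul
  rw [ENNReal.toReal_prod, ENNReal.toReal_prod] at hreal
  have hpos' : 0 < ∏ e, (p (g e)).toReal := by
    rw [← ENNReal.toReal_prod]
    exact ENNReal.toReal_pos hpos (htop _)
  have key := oldCommon_le_newCommon_of_prod_le (r := fun b => (p b).toReal)
    (fun _ => ENNReal.toReal_nonneg) hcor (liftPerm (π⁻¹ * πhat)) g hpos' hreal
  by_contra hne
  have := hg (π⁻¹ * πhat) (fun h1 => hne (inv_mul_eq_one.1 h1).symm)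
  omega

theorem prodProb_goodEvent_le_successProb {n : ℕ} {p : PMF (Bool × Bool)} {est : Estimator n}
    (hest : IsMAP p est) (hcor : pr p false true * pr p true false <
      pr p true true * pr p false false) :
    prodProb (fun b => (p b).toReal) (goodEvent n) ≤ successProb p est := by
  classical
  rw [successProb]
  have htop : ∀ h : VPair n → Bool × Bool, ∏ e, p (h e) ≠ ⊤ := fun h =>
    ENNReal.prod_ne_top fun e _ => p.apply_ne_top _
  have h1 : prodProb (fun b => (p b).toReal) (goodEvent n) =
      (∑ g : VPair n → Bool × Bool,
        (goodEvent n).indicator (fun g => ∏ e, p (g e)) g).toReal := by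
    rw [ENNReal.toReal_sum]
    · refine Finset.sum_congr rfl fun g _ => ?_
      by_cases hg : g ∈ goodEvent n <;> simp [hg, ENNReal.toReal_prod]
    · intro g _
      by_cases hg : g ∈ goodEvent n
      · simpa [hg] using htop g
      · simp [hg]
  rw [h1]
  refine ENNReal.toReal_mono
    (ne_top_of_le_ne_top ENNReal.one_ne_top (toOuterMeasure_le_one _ _)) ?_
  rw [PMF.toOuterMeasure_bind_apply, tsum_fintype, Fintype.sum_prod_type]
  refine Finset.sum_le_sum fun g _ => ?_
  by_cases hg : g ∈ goodEvent n
  · rw [Set.indicator_of_mem hg]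
    by_cases hpos : ∏ e, p (g e) = 0
    · simp [hpos]
    have h2 : ∀ π : Equiv.Perm (Fin n), ((est (observe (g, π))).map fun πhat =>
        (π, πhat)).toOuterMeasure {x | x.2 = x.1} = 1 := by
      intro π
      rw [PMF.toOuterMeasure_apply_eq_one_iff, PMF.support_map]
      rintro _ ⟨πhat, h, rfl⟩
      exact eq_of_mem_support_of_isMAP hest hcor hg hpos h
    simp only [h2, planted_apply, mul_one, Finset.sum_const, Finset.card_univ, nsmul_eq_mul]
    rw [mul_left_comm, ENNReal.mul_inv_cancel (by simp [Fintype.card_ne_zero]) (by simp), mul_one]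
  · rw [Set.indicator_of_notMem hg]
    exact zero_le

theorem successProb_le_one {n : ℕ} (p : PMF (Bool × Bool)) (est : Estimator n) :
    successProb p est ≤ 1 :=
  ENNReal.toReal_le_of_le_ofReal zero_le_one ((toOuterMeasure_le_one _ _).trans_eq ENNReal.ofReal_one.symm)

/-! ### Union bound over permutations and supports -/

/-- For supports larger than κ, either the pairs meeting the support hold few common edges, an event
indexed by sets, or the new count exceeds k(t − 1). The −1 pays for the at most k fixed pairs
meeting the support. -/
theorem prodProb_compl_goodEvent_le {n : ℕ} (hn : 0 < n) {r : Bool × Bool → ℝ}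
    (hr : ∀ b, 0 ≤ r b) {κ t y₁ y₂ β : ℝ} (hy₁ : 0 ≤ y₁) (hy₁' : y₁ ≤ 1 / 2) (hy₂ : 0 ≤ y₂)
    (hy₂' : y₂ ≤ 1 / 2) (hβ : 0 ≤ β)
    (hsmall : ∀ σ : Equiv.Perm (Fin n), (σ.support.card : ℝ) ≤ κ →
      prodProb r {g | oldCommon (liftPerm σ) g ≤ newCommon (liftPerm σ) g} ≤
        (y₁ / n) ^ σ.support.card)
    (hset : ∀ S : Finset (Fin n), κ < S.card →
      prodProb r {g | (commonIn (touching S) g : ℝ) ≤ S.card * t} ≤ β)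
    (hlarge : ∀ σ : Equiv.Perm (Fin n), κ < (σ.support.card : ℝ) →
      prodProb r {g | (σ.support.card * (t - 1) : ℝ) ≤ newCommon (liftPerm σ) g} ≤
        (y₂ / n) ^ σ.support.card) :
    prodProb r (goodEvent n)ᶜ ≤ 2 * y₁ + 2 ^ n * β + 2 * y₂ := by
  classical
  let A : Equiv.Perm (Fin n) → Set (VPair n → Bool × Bool) := fun σ =>
    {g | (σ.support.card : ℝ) ≤ κ ∧ oldCommon (liftPerm σ) g ≤ newCommon (liftPerm σ) g}
  let B : Finset (Fin n) → Set (VPair n → Bool × Bool) := fun S =>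
    {g | κ < S.card ∧ (commonIn (touching S) g : ℝ) ≤ S.card * t}
  let D : Equiv.Perm (Fin n) → Set (VPair n → Bool × Bool) := fun σ =>
    {g | κ < (σ.support.card : ℝ) ∧
      (σ.support.card * (t - 1) : ℝ) ≤ newCommon (liftPerm σ) g}
  let s : Finset (Equiv.Perm (Fin n)) := Finset.univ.filter fun σ => σ ≠ 1
  have hsub : (goodEvent n)ᶜ ⊆ ((⋃ σ ∈ s, A σ) ∪ ⋃ S ∈ (Finset.univ : Finset (Finset (Fin n))), B S)
      ∪ ⋃ σ ∈ s, D σ := by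
    intro g hg
    simp only [goodEvent, Set.mem_compl_iff, Set.mem_ofPred_eq, not_forall, not_lt] at hg
    obtain ⟨σ, hσ, hle⟩ := hg
    have hσs : σ ∈ s := by simp [s, hσ]
    rcases le_or_gt (σ.support.card : ℝ) κ with hκ | hκ
    · exact Or.inl (Or.inl (Set.mem_biUnion hσs ⟨hκ, hle⟩))
    · by_cases hB : (commonIn (touching σ.support) g : ℝ) ≤ σ.support.card * t
      · exact Or.inl (Or.inr (Set.mem_biUnion (Finset.mem_coe.2 (Finset.mem_univ _)) ⟨hκ, hB⟩))
      · refine Or.inr (Set.mem_biUnion hσs ⟨hκ, ?_⟩)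
        have h1 : (commonIn (touching σ.support) g : ℝ) ≤
            newCommon (liftPerm σ) g + σ.support.card := by
          exact_mod_cast (commonIn_touching_le σ g).trans (Nat.add_le_add_right hle _)
        linarith
  have hempty : prodProb r (∅ : Set (VPair n → Bool × Bool)) = 0 := by simp [prodProb]
  have hn' : (0 : ℝ) < n := by exact_mod_cast hn
  have hA : ∑ σ ∈ s, prodProb r (A σ) ≤ 2 * y₁ := by
    refine (Finset.sum_le_sum fun σ _ => ?_).trans (sum_perm_pow_support_card_le hn hy₁ hy₁')
    by_cases h : (σ.support.card : ℝ) ≤ κ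
    · simpa [A, h] using hsmall σ h
    · simp only [A, h, false_and, Set.ofPred_false, hempty]
      positivity
  have hB : ∑ S ∈ (Finset.univ : Finset (Finset (Fin n))), prodProb r (B S) ≤ 2 ^ n * β := by
    refine (Finset.sum_le_card_nsmul _ _ β fun S _ => ?_).trans_eq ?_
    · by_cases h : κ < S.card
      · simpa [B, h] using hset S h
      · simpa only [B, h, false_and, Set.ofPred_false, hempty] using hβ
    · simp
  have hD : ∑ σ ∈ s, prodProb r (D σ) ≤ 2 * y₂ := by
    refine (Finset.sum_le_sum fun σ _ => ?_).trans (sum_perm_pow_support_card_le hn hy₂ hy₂')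
    by_cases h : κ < (σ.support.card : ℝ)
    · simpa only [D, h, true_and] using hlarge σ h
    · simp only [D, h, false_and, Set.ofPred_false, hempty]
      positivity
  refine (prodProb_mono hr hsub).trans ((prodProb_union_le hr _ _).trans ?_)
  refine add_le_add ((prodProb_union_le hr _ _).trans (add_le_add ?_ ?_)) ?_
  · exact (prodProb_biUnion_le hr _ _).trans hA
  · exact (prodProb_biUnion_le hr _ _).trans hB
  · exact (prodProb_biUnion_le hr _ _).trans hD

/-! ### Estimates in the sparse regime -/

theorem frobSq_inv_self {r : Bool × Bool → ℝ} (h1 : ∑ b, r b = 1) {z : ℝ} (hz : z ≠ 0) :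
    frobSq r z⁻¹ z = 1 - 2 * (r (false, false) * r (true, true) * (1 - 1 / z) -
      r (false, true) * r (true, false) * (z - 1)) := by
  simp only [Fintype.sum_prod_type, Fintype.sum_bool] at h1
  have h : r (false, false) = 1 - r (true, true) - r (true, false) - r (false, true) := by linarith
  rw [frobSq, h]
  field_simp
  ring

theorem frobSq_one {r : Bool × Bool → ℝ} (h1 : ∑ b, r b = 1) (z : ℝ) :
    frobSq r 1 z = 1 + (z - 1) * (2 * r (true, true) *
      (r (true, true) + r (true, false) + r (false, true)) +
      2 * (r (false, true) * r (true, false)) + r (true, true) ^ 2 * (z - 1)) := by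
  simp only [Fintype.sum_prod_type, Fintype.sum_bool] at h1
  have h : r (false, false) = 1 - r (true, true) - r (true, false) - r (false, true) := by linarith
  rw [frobSq, h]
  ring

theorem sqrt_one_add_two_mul_le_exp (x : ℝ) : √(1 + 2 * x) ≤ Real.exp x := by
  rw [Real.sqrt_le_left (Real.exp_pos x).le, ← Real.exp_nat_mul]
  have := Real.add_one_le_exp (2 * x)
  push_cast
  linarith

theorem exp_pow_eq_div_pow {n : ℕ} (hn : 0 < n) (x : ℝ) (k : ℕ) :
    (Real.exp x / n) ^ k = Real.exp (k * (x - Real.log n)) := by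
  have hn' : (0 : ℝ) < n := by exact_mod_cast hn
  rw [Real.exp_nat_mul, Real.exp_sub, Real.exp_log hn']

/-- Finite-size conditions on the edge law under which the union bound is effective. -/
structure SparseLaw (n : ℕ) (r : Bool × Bool → ℝ) (C w : ℝ) : Prop where
  nonneg : ∀ b, 0 ≤ r b
  sum_eq_one : ∑ b, r b = 1
  two_le : 2 ≤ n
  one_le : 1 ≤ C
  w_nonneg : 0 ≤ w
  le_log : 1 + 3 * C ≤ Real.log n
  log_sq_le : Real.log n ^ 2 ≤ n
  lower : (Real.log n + w) / n ≤ r (true, true)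
  upper : r (true, true) ≤ C * (Real.log n / n)
  sparse : r (false, true) + r (true, false) ≤ C * (1 / Real.log n)
  corr : r (false, true) * r (true, false) ≤
    C * (1 / Real.log n ^ 3) * (r (true, true) * r (false, false))

namespace SparseLaw

variable {n : ℕ} {r : Bool × Bool → ℝ} {C w : ℝ}

theorem upper_le (h : SparseLaw n r C w) : r (true, true) ≤ C * (1 / Real.log n) := by
  have hL : 0 < Real.log n := by linarith [h.le_log, h.one_le]
  have hn : (0 : ℝ) < n := by exact_mod_cast (by linarith [h.two_le] : 0 < n)
  refine h.upper.trans (mul_le_mul_of_nonneg_left ?_ (by linarith [h.one_le]))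
  rw [div_le_div_iff₀ hn hL]
  linarith [h.log_sq_le]

theorem le_zero_zero (h : SparseLaw n r C w) : 1 - 2 * C / Real.log n ≤ r (false, false) := by
  have h1 := h.sum_eq_one
  simp only [Fintype.sum_prod_type, Fintype.sum_bool] at h1
  have := h.upper_le
  have := h.sparse
  have e : 2 * C / Real.log n = C * (1 / Real.log n) + C * (1 / Real.log n) := by ring
  linarith

theorem zero_zero_le_one (h : SparseLaw n r C w) : r (false, false) ≤ 1 := by
  rw [← h.sum_eq_one]
  exact Finset.single_le_sum (fun b _ => h.nonneg b) (Finset.mem_univ _)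

theorem zero_zero_pos (h : SparseLaw n r C w) : 0 < r (false, false) := by
  have hL : 0 < Real.log n := by linarith [h.le_log, h.one_le]
  refine lt_of_lt_of_le ?_ h.le_zero_zero
  rw [sub_pos, div_lt_one hL]
  linarith [h.le_log, h.one_le]

theorem log_div_le (h : SparseLaw n r C w) : Real.log n / n ≤ r (true, true) :=
  le_trans (div_le_div_of_nonneg_right (by linarith [h.w_nonneg]) (by positivity)) h.lower

theorem one_one_pos (h : SparseLaw n r C w) : 0 < r (true, true) := by
  have hL : 0 < Real.log n := by linarith [h.le_log, h.one_le]
  have hn : (0 : ℝ) < n := by exact_mod_cast (by linarith [h.two_le] : 0 < n)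
  exact lt_of_lt_of_le (by positivity) h.log_div_le

/-- Chernoff with u = 1/z and z = log n: large enough that the loss 1/z costs O(1) against p11 n =
O(log n), small enough that p01 p10 z stays negligible by the correlation hypothesis. -/
theorem prodProb_small_le (h : SparseLaw n r C w) (σ : Equiv.Perm (Fin n))
    (hσ : (σ.support.card : ℝ) ≤ 32 * n / Real.log n) :
    prodProb r {g | oldCommon (liftPerm σ) g ≤ newCommon (liftPerm σ) g} ≤
      (Real.exp (19 * C + 3 * C ^ 2 - w) / n) ^ σ.support.card := by
  have hC := h.one_le
  have hLC := h.le_log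
  have hL1 : 1 ≤ Real.log n := by linarith
  have hn0 : 0 < n := by linarith [h.two_le]
  have hn : (0 : ℝ) < n := by exact_mod_cast hn0
  refine (prodProb_oldCommon_le_newCommon_le h.nonneg h.sum_eq_one h.zero_zero_pos h.one_one_pos
    hL1 (liftPerm σ)).trans ?_
  rw [exp_pow_eq_div_pow hn0, frobSq_inv_self h.sum_eq_one (by linarith)]
  have ha := h.one_one_pos
  have hc := h.zero_zero_pos
  have hc1 := h.zero_zero_le_one
  have hc2 := h.le_zero_zero
  have hcorr := h.corr
  have hupper := h.upper
  have hlower := h.lower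
  have hlogsq := h.log_sq_le
  have hbb : 0 ≤ r (false, true) * r (true, false) := mul_nonneg (h.nonneg _) (h.nonneg _)
  have hm := le_card_moved σ
  set a := r (true, true)
  set c := r (false, false)
  set b := r (false, true) * r (true, false)
  set L := Real.log n
  set m := (Finset.univ.filter fun e => liftPerm σ e ≠ e).card
  set k : ℝ := (σ.support.card : ℝ)
  have hL0 : 0 < L := by linarith
  set d := c * a * (1 - 1 / L) - b * (L - 1) with hd
  have hca : 0 < c * a := mul_pos hc ha
  have hda : d ≤ a := by
    have h1 : c * a * (1 - 1 / L) ≤ c * a * 1 :=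
      mul_le_mul_of_nonneg_left (by linarith [one_div_pos.2 hL0]) hca.le
    have h2 : c * a ≤ 1 * a := mul_le_mul_of_nonneg_right hc1 ha.le
    have h3 : 0 ≤ b * (L - 1) := mul_nonneg hbb (by linarith)
    linarith
  have hbL : b * (L - 1) ≤ c * a * (C / L) := by
    have h1 : b * (L - 1) ≤ C * (1 / L ^ 3) * (a * c) * L :=
      mul_le_mul hcorr (by linarith) (by linarith) (by positivity)
    have h2 : C * (1 / L ^ 3) * (a * c) * L = c * a * (C / L ^ 2) := by
      field_simp
    have h3 : C / L ^ 2 ≤ C / L :=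
      div_le_div_of_nonneg_left (by linarith) hL0 (by nlinarith)
    have h4 := mul_le_mul_of_nonneg_left h3 hca.le
    linarith
  -- The relative loss (1 + 3C)/L collects 1 from 1/z, C from p01 p10, and 2C from p00 ≥ 1 − 2C/L.
  have hd1 : a * (1 - (1 + 3 * C) / L) ≤ d := by
    have h1 : c * a * (1 - (1 + C) / L) ≤ d := by
      have : c * a * (1 - (1 + C) / L) = c * a * (1 - 1 / L) - c * a * (C / L) := by ring
      linarith
    have h2 : 0 ≤ 1 - (1 + C) / L := by
      rw [sub_nonneg, div_le_one hL0]
      linarith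
    have h3 : (1 - 2 * C / L) * (1 - (1 + C) / L) ≤ c * (1 - (1 + C) / L) :=
      mul_le_mul_of_nonneg_right hc2 h2
    have h4 : 1 - (1 + 3 * C) / L ≤ (1 - 2 * C / L) * (1 - (1 + C) / L) := by
      have : (1 - 2 * C / L) * (1 - (1 + C) / L) =
          1 - (1 + 3 * C) / L + 2 * C * (1 + C) / L ^ 2 := by
        field_simp
        ring
      have : 0 ≤ 2 * C * (1 + C) / L ^ 2 := by positivity
      linarith
    have h5 := mul_le_mul_of_nonneg_left (h4.trans h3) ha.le
    have h6 : a * (c * (1 - (1 + C) / L)) = c * a * (1 - (1 + C) / L) := by ring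
    linarith
  have hd0 : 0 ≤ d := by
    refine le_trans (mul_nonneg ha.le ?_) hd1
    rw [sub_nonneg, div_le_one hL0]
    exact hLC
  have hk0 : 0 ≤ k := Nat.cast_nonneg _
  have hLn : L ≤ n := by nlinarith
  -- The loss is (1 + 3C)C from `g4` and 18C from `g5`; the latter is where k ≤ 32n/L keeps d · k/2
  -- bounded.
  have hmain : L + w - (19 * C + 3 * C ^ 2) ≤ d * (n - k / 2 - 3 / 2) := by
    have g1 : L + w ≤ a * n := (div_le_iff₀ hn).1 hlower
    have g2 : a * n ≤ C * L := by
      have := mul_le_mul_of_nonneg_right hupper hn.le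
      have e : C * (L / n) * n = C * L := by field_simp
      linarith
    have g3 : a * n / L ≤ C := (div_le_iff₀ hL0).2 g2
    have g4 : a * n - (1 + 3 * C) * C ≤ d * n := by
      have h1 := mul_le_mul_of_nonneg_right hd1 hn.le
      have h2 : a * (1 - (1 + 3 * C) / L) * n = a * n - (1 + 3 * C) * (a * n / L) := by ring
      have h3 := mul_le_mul_of_nonneg_left g3 (by linarith : 0 ≤ 1 + 3 * C)
      linarith
    have g5 : d * (k / 2 + 3 / 2) ≤ 18 * C := by
      have h1 : d * (k / 2 + 3 / 2) ≤ a * (16 * n / L + 3 / 2) := by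
        refine mul_le_mul hda ?_ (by positivity) ha.le
        have : 32 * (n : ℝ) / L = 2 * (16 * n / L) := by ring
        linarith
      have h2 : a * (16 * n / L + 3 / 2) = 16 * (a * n / L) + 3 / 2 * a := by ring
      have h3 : a ≤ C := by
        refine hupper.trans ?_
        exact mul_le_of_le_one_right (by linarith) ((div_le_one hn).2 hLn)
      linarith
    have g6 : d * (n - k / 2 - 3 / 2) = d * n - d * (k / 2 + 3 / 2) := by ring
    linarith
  rw [show 1 - 2 * d = 1 + 2 * (-d) by ring]
  refine (pow_le_pow_left₀ (Real.sqrt_nonneg _) (sqrt_one_add_two_mul_le_exp (-d)) m).trans ?_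
  rw [← Real.exp_nat_mul, Real.exp_le_exp]
  have h1 := mul_le_mul_of_nonneg_left hm hd0
  have h2 := mul_le_mul_of_nonneg_left hmain hk0
  linarith

theorem prodProb_commonIn_touching_le (h : SparseLaw n r C w) (S : Finset (Fin n))
    (hS : 32 * n / Real.log n < S.card) :
    prodProb r {g | (commonIn (touching S) g : ℝ) ≤ S.card * (Real.log n / 16)} ≤
      Real.exp (-(2 * n)) := by
  have hL0 : 0 < Real.log n := by linarith [h.le_log, h.one_le]
  have hn2 : (2 : ℝ) ≤ n := by exact_mod_cast h.two_le
  have hn : (0 : ℝ) < n := by linarith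
  refine (prodProb_commonIn_le_le h.nonneg h.sum_eq_one _ _).trans ?_
  rw [Real.exp_le_exp, card_touching]
  have hk : (S.card : ℝ) ≤ n := by exact_mod_cast (by simpa using S.card_le_univ)
  have ha := h.log_div_le
  rw [div_le_iff₀ hn] at ha
  rw [div_lt_iff₀ hL0] at hS
  have hk0 : (0 : ℝ) ≤ S.card := Nat.cast_nonneg _
  set k : ℝ := (S.card : ℝ)
  -- Here k ≤ n and n ≥ 2 give n − k/2 − 1/2 ≥ n/4. The exponent is then at most kL/16 − kL/8 =
  -- −kL/16 < −2n, since kL > 32n.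
  have h1 : r (true, true) * (k * (n / 4)) ≤ r (true, true) * (k * (n - k / 2 - 1 / 2)) :=
    mul_le_mul_of_nonneg_left (mul_le_mul_of_nonneg_left (by linarith) hk0) h.one_one_pos.le
  have h2 := mul_le_mul_of_nonneg_left ha hk0
  nlinarith

theorem prodProb_large_le (h : SparseLaw n r C w) (σ : Equiv.Perm (Fin n)) :
    prodProb r {g | (σ.support.card * (Real.log n / 16 - 1) : ℝ) ≤ newCommon (liftPerm σ) g} ≤
      (Real.exp (64 + Real.exp 64 * (6 + Real.exp 64) * C ^ 2 - 3 * Real.log n) / n) ^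
        σ.support.card := by
  have hC := h.one_le
  have hLC := h.le_log
  have hn0 : 0 < n := by linarith [h.two_le]
  have hn : (0 : ℝ) < n := by exact_mod_cast hn0
  -- The tilt 64 turns the threshold kL/16 into a factor exp(−4kL): one kL cancels the n^k
  -- permutations and three remain.
  refine (prodProb_le_newCommon_le h.nonneg h.sum_eq_one h.zero_zero_pos h.one_one_pos
    (s := 64) (by norm_num) _ (liftPerm σ)).trans ?_
  rw [exp_pow_eq_div_pow hn0, frobSq_one h.sum_eq_one]
  have ha := h.one_one_pos
  have hc1 := h.zero_zero_le_one
  have hupper := h.upper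
  have hupper' := h.upper_le
  have hcorr := h.corr
  have hsparse := h.sparse
  have hm := card_moved_le σ
  have hz1 : 1 ≤ Real.exp 64 := Real.one_le_exp (by norm_num)
  have hc0 := h.zero_zero_pos
  have hbb : 0 ≤ r (false, true) * r (true, false) := mul_nonneg (h.nonneg _) (h.nonneg _)
  have h01 := h.nonneg (false, true)
  have h10 := h.nonneg (true, false)
  set a := r (true, true)
  set c := r (false, false)
  set L := Real.log n
  set z := Real.exp 64
  set m := (Finset.univ.filter fun e => liftPerm σ e ≠ e).card
  set k : ℝ := (σ.support.card : ℝ)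
  have hL1 : 1 ≤ L := by linarith
  have hL0 : 0 < L := by linarith
  -- Every second-order term pairs a factor O(L/n) with a factor O(1/L), so `frobSq` is 1 + O(1/n),
  -- and its contribution over at most kn moved pairs is exp(O(k)).
  have hmulC : C * (L / n) * (C * (1 / L)) = C ^ 2 / n := by
    field_simp
  have haa : a * a ≤ C ^ 2 / n := by
    rw [← hmulC]
    exact mul_le_mul hupper hupper' ha.le (by positivity)
  have hab : a * (r (true, false) + r (false, true)) ≤ C ^ 2 / n := by
    rw [← hmulC]
    exact mul_le_mul hupper (by linarith) (by linarith) (by positivity)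
  have hb : r (false, true) * r (true, false) ≤ C ^ 2 / n := by
    refine hcorr.trans ?_
    have h1 : a * c ≤ C * (L / n) := by nlinarith
    have h2 : 1 / L ^ 3 ≤ 1 / L := by
      apply one_div_le_one_div_of_le hL0
      nlinarith [sq_nonneg (L - 1), mul_nonneg hL0.le (by nlinarith : 0 ≤ L ^ 2 - 1)]
    rw [← hmulC, mul_comm (C * (L / n))]
    exact mul_le_mul (mul_le_mul_of_nonneg_left h2 (by linarith)) h1 (by positivity)
      (by positivity)
  set D := z * (6 + z) * C ^ 2 with hD
  have hx : (z - 1) * (2 * a * (a + r (true, false) + r (false, true)) +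
      2 * (r (false, true) * r (true, false)) + a ^ 2 * (z - 1)) ≤ D / n := by
    have h1 : a ^ 2 * (z - 1) ≤ C ^ 2 / n * z :=
      mul_le_mul (by linarith) (by linarith) (by linarith) (by positivity)
    have h2 : 2 * a * (a + r (true, false) + r (false, true)) +
      2 * (r (false, true) * r (true, false)) + a ^ 2 * (z - 1) ≤ (6 + z) * (C ^ 2 / n) := by
      linarith
    have h3 : D / n = z * ((6 + z) * (C ^ 2 / n)) := by
      rw [hD]
      ring
    rw [h3]
    refine mul_le_mul (by linarith) h2 ?_ (by linarith)
    have := mul_nonneg (sq_nonneg a) (by linarith : 0 ≤ z - 1)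
    positivity
  have hD0 : 0 ≤ D := by positivity
  have hsq : √(1 + (z - 1) * (2 * a * (a + r (true, false) + r (false, true)) +
      2 * (r (false, true) * r (true, false)) + a ^ 2 * (z - 1))) ≤ Real.exp (D / n) := by
    refine le_trans (Real.sqrt_le_sqrt ?_) (sqrt_one_add_two_mul_le_exp (D / n))
    have : 0 ≤ D / n := by positivity
    linarith
  refine (mul_le_mul_of_nonneg_left (pow_le_pow_left₀ (Real.sqrt_nonneg _) hsq m)
    (Real.exp_pos _).le).trans ?_
  rw [← Real.exp_nat_mul, ← Real.exp_add, Real.exp_le_exp]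
  have h1 : m * (D / n) ≤ k * D := by
    have h2 := mul_le_mul_of_nonneg_right hm (by positivity : 0 ≤ D / n)
    have h3 : k * n * (D / n) = k * D := by field_simp
    linarith
  nlinarith

theorem prodProb_compl_goodEvent_le (h : SparseLaw n r C w)
    (h₁ : Real.exp (19 * C + 3 * C ^ 2 - w) ≤ 1 / 2)
    (h₂ : Real.exp (64 + Real.exp 64 * (6 + Real.exp 64) * C ^ 2 - 3 * Real.log n) ≤ 1 / 2) :
    prodProb r (goodEvent n)ᶜ ≤ 2 * Real.exp (19 * C + 3 * C ^ 2 - w) + Real.exp (-n) +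
      2 * Real.exp (64 + Real.exp 64 * (6 + Real.exp 64) * C ^ 2 - 3 * Real.log n) := by
  refine (GraphAlign.prodProb_compl_goodEvent_le (by linarith [h.two_le]) h.nonneg
    (Real.exp_pos _).le h₁ (Real.exp_pos _).le h₂ (Real.exp_pos _).le h.prodProb_small_le
    h.prodProb_commonIn_touching_le fun σ _ => h.prodProb_large_le σ).trans ?_
  have h3 : (2 : ℝ) ^ n * Real.exp (-(2 * n)) ≤ Real.exp (-n) := by
    have h4 : (2 : ℝ) ^ n ≤ Real.exp 1 ^ n :=
      pow_le_pow_left₀ (by norm_num) (by linarith [Real.add_one_le_exp (1 : ℝ)]) n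
    rw [← Real.exp_nat_mul, mul_one] at h4
    refine (mul_le_mul_of_nonneg_right h4 (Real.exp_pos _).le).trans_eq ?_
    rw [← Real.exp_add]
    congr 1
    ring
  linarith

end SparseLaw

theorem SparseLaw.corr_lt {n : ℕ} {r : Bool × Bool → ℝ} {C w : ℝ} (h : SparseLaw n r C w) :
    r (false, true) * r (true, false) < r (true, true) * r (false, false) := by
  have hC := h.one_le
  have hL := h.le_log
  have hac : 0 < r (true, true) * r (false, false) := mul_pos h.one_one_pos h.zero_zero_pos
  refine h.corr.trans_lt (mul_lt_of_lt_one_left hac ?_)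
  have h3 : Real.log n ≤ Real.log n ^ 3 := le_self_pow₀ (by linarith) (by norm_num)
  rw [mul_one_div, div_lt_one (by linarith)]
  linarith

/-! ### From asymptotic hypotheses to finite-size conditions -/

theorem sum_toReal_eq_one (p : PMF (Bool × Bool)) : ∑ b, (p b).toReal = 1 := by
  rw [← ENNReal.toReal_sum fun b _ => p.apply_ne_top b,
    ← tsum_fintype (L := .unconditional _), p.tsum_coe, ENNReal.toReal_one]

theorem exists_eventually_le_mul {f g : ℕ → ℝ} (h : f =O[atTop] g)
    (hg : ∀ᶠ n in atTop, 0 ≤ g n) :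
    ∃ C₀ : ℝ, ∀ C, C₀ ≤ C → ∀ᶠ n in atTop, f n ≤ C * g n := by
  obtain ⟨C₀, hC₀⟩ := h.bound
  refine ⟨C₀, fun C hC => ?_⟩
  filter_upwards [hC₀, hg] with n hn hgn
  rw [Real.norm_of_nonneg hgn] at hn
  exact (le_abs_self _).trans (hn.trans (mul_le_mul_of_nonneg_right hC hgn))

theorem tendsto_log_natCast : Tendsto (fun n : ℕ => Real.log n) atTop atTop :=
  Real.tendsto_log_atTop.comp (tendsto_natCast_atTop_atTop (R := ℝ))

theorem exists_eventually_sparseLaw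
    (p : ℕ → PMF (Bool × Bool)) (w : ℕ → ℝ) (hw : Tendsto w atTop atTop)
    (hp11_lower : ∀ᶠ n : ℕ in atTop, (Real.log n + w n) / n ≤ pr (p n) true true)
    (hp11_upper : (fun n : ℕ => pr (p n) true true) =O[atTop] fun n : ℕ => Real.log n / n)
    (hsparse : (fun n : ℕ => pr (p n) false true + pr (p n) true false)
      =O[atTop] fun n : ℕ => 1 / Real.log n)
    (hcorr : (fun n : ℕ => pr (p n) false true * pr (p n) true false /
        (pr (p n) true true * pr (p n) false false)) =O[atTop] fun n : ℕ => 1 / (Real.log n) ^ 3) :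
    ∃ C : ℝ, ∀ᶠ n : ℕ in atTop, SparseLaw n (fun b => (p n b).toReal) C (w n) := by
  have hlog0 : ∀ᶠ n : ℕ in atTop, 0 ≤ Real.log n :=
    tendsto_log_natCast.eventually_ge_atTop 0
  obtain ⟨C₁, h₁⟩ := exists_eventually_le_mul hp11_upper
    (hlog0.mono fun n hn => by positivity)
  obtain ⟨C₂, h₂⟩ := exists_eventually_le_mul hsparse (hlog0.mono fun n hn => by positivity)
  obtain ⟨C₃, h₃⟩ := exists_eventually_le_mul hcorr (hlog0.mono fun n hn => by positivity)
  set C := max 1 (max C₁ (max C₂ C₃)) with hC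
  have hC1 : 1 ≤ C := le_max_left _ _
  have hsq : ∀ᶠ n : ℕ in atTop, Real.log n ^ 2 ≤ n := by
    have h := (Real.isLittleO_pow_log_id_atTop (n := 2)).comp_tendsto
      (tendsto_natCast_atTop_atTop (R := ℝ))
    filter_upwards [h.bound one_pos] with n hn
    simpa using hn
  refine ⟨C, ?_⟩
  filter_upwards [h₁ C (by simp [hC]), h₂ C (by simp [hC]), h₃ C (by simp [hC]), hsq, hp11_lower,
    hw.eventually_ge_atTop 0, eventually_ge_atTop 2,
    tendsto_log_natCast.eventually_ge_atTop (1 + 3 * C)] with n k₁ k₂ k₃ ksq klow kw k2 klog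
  have hL : 0 < Real.log n := by linarith
  have hn : (0 : ℝ) < n := by exact_mod_cast (by linarith : 0 < n)
  have hapos : 0 < pr (p n) true true := lt_of_lt_of_le (by positivity) klow
  have hsum := sum_toReal_eq_one (p n)
  -- Positivity of p00 must come first: with p00 = 0 the quotient in `hcorr` would be 0 by
  -- convention and would say nothing about p01 p10.
  have hcpos : 0 < pr (p n) false false := by
    simp only [Fintype.sum_prod_type, Fintype.sum_bool] at hsum
    have e : pr (p n) false false =
        1 - pr (p n) true true - (pr (p n) false true + pr (p n) true false) := by
      simp only [pr]
      linarith
    have h4 : Real.log n / n ≤ 1 / Real.log n := by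
      rw [div_le_div_iff₀ hn hL]
      linarith
    have h5 := mul_le_mul_of_nonneg_left h4 (by linarith : 0 ≤ C)
    have h6 : 2 * (C * (1 / Real.log n)) < 1 := by
      rw [mul_one_div, ← mul_div_assoc, div_lt_one hL]
      linarith
    linarith
  exact
    { nonneg := fun b => ENNReal.toReal_nonneg
      sum_eq_one := hsum
      two_le := k2
      one_le := hC1
      w_nonneg := kw
      le_log := klog
      log_sq_le := ksq
      lower := klow
      upper := k₁
      sparse := k₂
      corr := (div_le_iff₀ (mul_pos hapos hcpos)).1 k₃ }

end GraphAlign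

theorem mainTheorem4
    (p : ℕ → PMF (Bool × Bool))
    (w : ℕ → ℝ) (hw : Tendsto w atTop atTop)
    (hp11_lower : ∀ᶠ n : ℕ in atTop,
      (Real.log n + w n) / n ≤ GraphAlign.pr (p n) true true)
    (hp11_upper : (fun n : ℕ => GraphAlign.pr (p n) true true)
      =O[atTop] fun n : ℕ => Real.log n / n)
    (hsparse : (fun n : ℕ => GraphAlign.pr (p n) false true + GraphAlign.pr (p n) true false)
      =O[atTop] fun n : ℕ => 1 / Real.log n)
    (hcorr : (fun n : ℕ => GraphAlign.pr (p n) false true * GraphAlign.pr (p n) true false /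
        (GraphAlign.pr (p n) true true * GraphAlign.pr (p n) false false))
      =O[atTop] fun n : ℕ => 1 / (Real.log n) ^ 3)
    (est : (n : ℕ) → GraphAlign.Estimator n)
    (hest : ∀ n, GraphAlign.IsMAP (p n) (est n)) :
    Tendsto (fun n : ℕ => GraphAlign.successProb (p n) (est n)) atTop (𝓝 1) := by
  obtain ⟨C, hC⟩ := GraphAlign.exists_eventually_sparseLaw p w hw hp11_lower hp11_upper
    hsparse hcorr
  have t₁ : Tendsto (fun n : ℕ => Real.exp (19 * C + 3 * C ^ 2 - w n)) atTop (𝓝 0) :=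
    Real.tendsto_exp_atBot.comp (tendsto_atBot_add_const_left _ _ (tendsto_neg_atTop_atBot.comp hw))
  have t₂ : Tendsto (fun n : ℕ => Real.exp (64 + Real.exp 64 * (6 + Real.exp 64) * C ^ 2 -
      3 * Real.log n)) atTop (𝓝 0) :=
    Real.tendsto_exp_atBot.comp (tendsto_atBot_add_const_left _ _
      (tendsto_neg_atTop_atBot.comp (GraphAlign.tendsto_log_natCast.const_mul_atTop three_pos)))
  have t₃ : Tendsto (fun n : ℕ => Real.exp (-n)) atTop (𝓝 0) :=
    Real.tendsto_exp_atBot.comp (tendsto_neg_atTop_atBot.comp tendsto_natCast_atTop_atTop)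
  have hlim := tendsto_const_nhds (x := (1 : ℝ)) |>.sub
    (((t₁.const_mul 2).add t₃).add (t₂.const_mul 2))
  simp only [mul_zero, add_zero, sub_zero] at hlim
  refine tendsto_of_tendsto_of_tendsto_of_le_of_le' hlim tendsto_const_nhds ?_
    (Eventually.of_forall fun n => GraphAlign.successProb_le_one _ _)
  filter_upwards [hC, t₁.eventually_le_const (by norm_num : (0 : ℝ) < 1 / 2),
    t₂.eventually_le_const (by norm_num : (0 : ℝ) < 1 / 2)] with n hn h₁ h₂
  have hbad := hn.prodProb_compl_goodEvent_le h₁ h₂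
  rw [GraphAlign.prodProb_compl hn.sum_eq_one] at hbad
  have hgood := GraphAlign.prodProb_goodEvent_le_successProb (hest n) hn.corr_lt
  linarith
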